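/- Let $r\ge 0$ and $n>n_d\ge 0$ be integers and let $0\le\beta<\gamma<\alpha<1$. Consider a dataset with $r+1$ classes of $n$ (augmented) samples each, and a set $\mathbb D_d$ of difficult-to-learn examples containing exactly $n_d$ samples of every class. The similarity of two samples $x,x'$ is $s_{xx'}=1$ if $x=x'$; $\alpha$ if $x\ne x'$ are in the same class; $\gamma$ if they are in different classes and both in $\mathbb D_d$; and $\beta$ otherwise. Let $\mathcal X$ be the subset obtained by removing all of $\mathbb D_d$. Let contrastive learning be carried out on $\mathcal X$: natural data $\bar x$ with labels $y(\bar x)\in\{1,\dots,r+1\}$ are drawn from a probability distribution $\mathcal P$, and are augmented to $x\in\mathcal X$ by a distribution $\mathcal A(\cdot\mid\bar x)$, in such a way that the augmentation graph $w_{xx'}=\mathbb E_{\bar x\sim\mathcal P}[\mathcal A(x\mid\bar x)\mathcal A(x'\mid\bar x)]$ is the similarity graph on $\mathcal X$ scaled to total weight one, i.e. $w_{xx'}=s_{xx'}/\sum_{z,z'\in\mathcal X}s_{zz'}$ for $x,x'\in\mathcal X$. Write $w_x=\sum_{x'}w_{xx'}$. For $f:\mathcal X\to\mathbb R^k$ let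 $$\mathcal L_{\mathrm{Spec}}(f)=-2\sum_{x,x'}w_{xx'}\,f(x)^\top f(x')+\sum_{x,x'}w_xw_{x'}\big(f(x)^\top f(x')\big)^2$$ be the spectral contrastive loss, and let the linear probing error of $f$ be $$\mathcal E(f)=\min_{B\in\mathbb R^{(r+1)\times k}}\Pr_{\bar x\sim\mathcal P,\;x\sim\mathcal A(\cdot\mid\bar x)}\Big[\arg\max_i\,(Bf(x))_i\ne y(\bar x)\Big],$$ where ties in the $\arg\max$ count as errors. Assume that 1. (labels are recoverable) there is a classifier $g:\mathcal X\to\{1,\dots,r+1\}$ with $\Pr_{\bar x,\,x}[g(x)=y(\bar x)]\ge 1-\delta$; 2. (realizability) the hypothesis class $\mathcal F$ of functions $\mathcal X\to\mathbb R^k$ contains a global minimizer of $\mathcal L_{\mathrm{Spec}}$ among all functions $\mathcal X\to\mathbb R^k$; 3. the feature dimension satisfies $k>r$. Then every model $f$ trained on $\mathcal X$, i.e. every minimizer $f$ of $\mathcal L_{\mathrm{Spec}}$ over $\mathcal F$, has linear probing error $\mathcal E_{\mathrm R}=\mathcal E(f)$ bounded by $$\mathcal E_{\mathrm R}\le\frac{4\delta}{1-\frac{1-\alpha}{(1-\alpha)+(n-n_d)\alpha+(n-n_d)r\beta}}+8\delta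 .$$ -/

import Mathlib

open MeasureTheory ProbabilityTheory

noncomputable section

/-- The population behind contrastive learning: a law `natural` of natural data, an augmentation
distribution `aug xbar` on the augmented samples `X` for every natural datum `xbar`, and the ground
truth label `label xbar` of every natural datum. -/
structure ContrastiveModel (Xbar X Y : Type*) [MeasurableSpace Xbar] [MeasurableSpace X]
    [MeasurableSpace Y] where
  natural : Measure Xbar
  isProbabilityMeasure_natural : IsProbabilityMeasure natural
  aug : Kernel Xbar X
  isMarkovKernel_aug : IsMarkovKernel aug
  label : Xbar → Y
  measurable_label : Measurable label

namespace ContrastiveModel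

variable {Xbar X Y : Type*} [MeasurableSpace Xbar] [MeasurableSpace X] [MeasurableSpace Y]

/-- The edge weight of the augmentation graph: `w x x' = E_xbar [aug(x | xbar) * aug(x' | xbar)]`,
the probability that two independent augmentations of one natural datum are `x` and `x'`. -/
def weight (M : ContrastiveModel Xbar X Y) (x x' : X) : ℝ :=
  ∫ xbar, (M.aug xbar).real {x} * (M.aug xbar).real {x'} ∂M.natural

/-- The vertex weight `w x = ∑ x', w x x'`, the probability of the augmented sample `x`. -/
def vertexWeight [Fintype X] (M : ContrastiveModel Xbar X Y) (x : X) : ℝ :=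
  ∑ x', M.weight x x'

/-- The joint law of a natural datum and one augmentation of it. -/
def joint (M : ContrastiveModel Xbar X Y) : Measure (Xbar × X) :=
  M.natural ⊗ₘ M.aug

/-- The population spectral contrastive loss
`-2 E_{x,x⁺} [f(x)ᵀ f(x⁺)] + E_{x,x'} [(f(x)ᵀ f(x'))²]`, with `(x, x⁺)` a positive pair, of law
`weight`, and `x`, `x'` independent, each of law `vertexWeight`. -/
def spectralLoss [Fintype X] {k : ℕ} (M : ContrastiveModel Xbar X Y)
    (f : X → EuclideanSpace ℝ (Fin k)) : ℝ :=
  -2 * ∑ x, ∑ x', M.weight x x' * inner ℝ (f x) (f x') +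
    ∑ x, ∑ x', M.vertexWeight x * M.vertexWeight x' * (inner ℝ (f x) (f x')) ^ 2

/-- Labels are recoverable from augmentations with error at most `δ`. -/
def LabelsRecoverable (M : ContrastiveModel Xbar X Y) (δ : ℝ) : Prop :=
  ∃ g : X → Y, 1 - δ ≤ M.joint.real {p | g p.2 = M.label p.1}

/-- Realizability: the hypothesis class contains a global minimizer of the spectral loss. -/
def Realizable [Fintype X] {k : ℕ} (M : ContrastiveModel Xbar X Y)
    (F : Set (X → EuclideanSpace ℝ (Fin k))) : Prop :=
  ∃ f ∈ F, ∀ h : X → EuclideanSpace ℝ (Fin k), M.spectralLoss f ≤ M.spectralLoss h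

/-- `f` is a model trained in the hypothesis class `F`: a minimizer of the spectral loss
over `F`. -/
def IsTrained [Fintype X] {k : ℕ} (M : ContrastiveModel Xbar X Y)
    (F : Set (X → EuclideanSpace ℝ (Fin k))) (f : X → EuclideanSpace ℝ (Fin k)) : Prop :=
  f ∈ F ∧ ∀ h ∈ F, M.spectralLoss f ≤ M.spectralLoss h

/-- The error of the classifier `x ↦ argmax_i (B f(x))_i`: the probability that the label of
`xbar` is not the unique argmax at the augmentation `x` of `xbar`. Ties count as errors, so this
dominates the error under every rule for breaking ties. -/
def probeError {k : ℕ} (M : ContrastiveModel Xbar X Y) (f : X → EuclideanSpace ℝ (Fin k))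
    (B : Matrix Y (Fin k) ℝ) : ℝ :=
  M.joint.real {p | ∃ j, j ≠ M.label p.1 ∧
    (B.mulVec (f p.2)) (M.label p.1) ≤ (B.mulVec (f p.2)) j}

/-- The linear probing error of the features `f`: the least error over all linear probes. -/
def linearProbingError {k : ℕ} (M : ContrastiveModel Xbar X Y)
    (f : X → EuclideanSpace ℝ (Fin k)) : ℝ :=
  ⨅ B : Matrix Y (Fin k) ℝ, M.probeError f B

/-- The augmentation graph of `M` has adjacency matrix `S`, scaled to total weight `1`. -/
def HasSimilarityGraph [Fintype X] (M : ContrastiveModel Xbar X Y) (S : Matrix X X ℝ) : Prop :=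
  ∀ x x', M.weight x x' = S x x' / ∑ z, ∑ z', S z z'

end ContrastiveModel

/-- The similarity matrix of a dataset of `r + 1` classes with `n` samples each, the sample `(i, j)`
being the `j`-th one of class `i`; `D` is the set of difficult-to-learn examples. -/
def similarityMatrix {r n : ℕ} (D : Finset (Fin (r + 1) × Fin n)) (α β γ : ℝ) :
    Matrix (Fin (r + 1) × Fin n) (Fin (r + 1) × Fin n) ℝ :=
  fun x x' =>
    if x = x' then 1
    else if x.1 = x'.1 then α
    else if x ∈ D ∧ x' ∈ D then γ
    else β

/-- The selected subset: the dataset without its difficult-to-learn examples. -/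
abbrev EasySample {r n : ℕ} (D : Finset (Fin (r + 1) × Fin n)) : Type :=
  {x : Fin (r + 1) × Fin n // x ∉ D}

end

open MeasureTheory ProbabilityTheory Finset

/-! Without the difficult examples `γ` disappears: the similarity matrix is `(1-α)` times the
identity, plus `α-β` on pairs of one class, plus `β` everywhere. All row sums equal `d`, so vertex
weights are uniform and the spectral loss is, up to scaling, the error of approximating a block
matrix by the Gram matrix of `f`. Two facts give the bound. By first- and second-order optimality,
the features of a global minimizer of dimension at least `r+1` represent linearly every function
constant on classes (`exists_inner_eq_comp_of_gramLoss_le`), so a probe can output any one label per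
class. The true labels need not follow the classes, so the label chosen is the majority label of the
recovering classifier `g`. Since `g` disagrees on a positive pair with probability at most `2δ`
(`sum_weight_ne_le`), while each deviation from the majority forces many disagreeing pairs
(`exists_majority_card_le`), the majority differs from `g` with probability at most `2δ / (1 -
(1-α)/d)`. Adding the error `δ` of `g` bounds the probe error. -/

/-! ### Optimality conditions for quartics in one variable -/

/-- A quartic without constant term that is nonnegative everywhere has no linear term. -/
theorem linear_coeff_eq_zero_of_nonneg {a b c d : ℝ}
    (h : ∀ t : ℝ, 0 ≤ a * t + b * t ^ 2 + c * t ^ 3 + d * t ^ 4) : a = 0 := by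
  have hmin : IsLocalMin (fun t : ℝ => a * t + b * t ^ 2 + c * t ^ 3 + d * t ^ 4) 0 :=
    Filter.Eventually.of_forall fun t => by simpa using h t
  have hd : HasDerivAt (fun t : ℝ => a * t + b * t ^ 2 + c * t ^ 3 + d * t ^ 4) a 0 := by
    have := ((((hasDerivAt_id (0 : ℝ)).const_mul a).add
      ((hasDerivAt_pow 2 (0 : ℝ)).const_mul b)).add
      ((hasDerivAt_pow 3 (0 : ℝ)).const_mul c)).add ((hasDerivAt_pow 4 (0 : ℝ)).const_mul d)
    exact this.congr_deriv (by norm_num)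
  exact hmin.hasDerivAt_eq_zero hd

/-- A quartic without constant and linear term that is nonnegative everywhere has a nonnegative
quadratic term. -/
theorem quadratic_coeff_nonneg_of_nonneg {b c d : ℝ}
    (h : ∀ t : ℝ, 0 ≤ b * t ^ 2 + c * t ^ 3 + d * t ^ 4) : 0 ≤ b := by
  by_contra! hb
  set s := b ^ 2 + d ^ 2 + 1
  -- Adding the values at `t` and `-t` cancels the cubic term.
  have key : ∀ t : ℝ, 0 < t → 0 ≤ b + d * t ^ 2 := by
    intro t ht
    have h1 := h t
    have h2 := h (-t)
    have : 0 ≤ t ^ 2 * (b + d * t ^ 2) := by nlinarith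
    exact nonneg_of_mul_nonneg_right this (by positivity)
  have hd : 0 < |d| + 1 := by positivity
  have hq : 0 < -b / (2 * (|d| + 1)) := div_pos (by linarith) (by positivity)
  -- At this `t` the term `d * t ^ 2` is at most `-b / 2`, too small to compensate `b < 0`.
  have h1 := key (Real.sqrt (-b / (2 * (|d| + 1)))) (Real.sqrt_pos.2 hq)
  rw [Real.sq_sqrt hq.le] at h1
  have h2 : d * (-b / (2 * (|d| + 1))) ≤ (|d| + 1) * (-b / (2 * (|d| + 1))) :=
    mul_le_mul_of_nonneg_right (by linarith [le_abs_self d]) hq.le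
  have h3 : (|d| + 1) * (-b / (2 * (|d| + 1))) = -b / 2 := by
    field_simp
  linarith

/-! ### Global minimizers of the Gram loss -/

section GramLoss

variable {X Y E : Type*} [Fintype X] [NormedAddCommGroup E] [InnerProductSpace ℝ E]

/-- The loss `‖G - f fᵀ‖² - ‖G‖²` of approximating a matrix `G` by the Gram matrix of `f`. -/
def gramLoss (G : Matrix X X ℝ) (f : X → E) : ℝ :=
  -2 * ∑ x, ∑ x', G x x' * inner ℝ (f x) (f x') + ∑ x, ∑ x', (inner ℝ (f x) (f x')) ^ 2

/-- Rank-one perturbations turn the loss into a quartic in `t`, whose first two coefficients carry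
the optimality conditions. -/
theorem gramLoss_add_smul (G : Matrix X X ℝ) (f : X → E) (v : X → ℝ) (u : E) (t : ℝ) :
    gramLoss G (fun x => f x + (t * v x) • u) = gramLoss G f +
      ((∑ x, ∑ x', 2 * (inner ℝ (f x) (f x') - G x x') *
          (v x' * inner ℝ (f x) u + v x * inner ℝ (f x') u)) * t +
       (∑ x, ∑ x', (2 * ‖u‖ ^ 2 * (inner ℝ (f x) (f x') - G x x') * (v x * v x') +
          (v x' * inner ℝ (f x) u + v x * inner ℝ (f x') u) ^ 2)) * t ^ 2 +
       (∑ x, ∑ x', 2 * ‖u‖ ^ 2 * (v x * v x') *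
          (v x' * inner ℝ (f x) u + v x * inner ℝ (f x') u)) * t ^ 3 +
       (∑ x, ∑ x', ‖u‖ ^ 4 * (v x * v x') ^ 2) * t ^ 4) := by
  have key : ∀ x x', inner ℝ (f x + (t * v x) • u) (f x' + (t * v x') • u) =
      inner ℝ (f x) (f x') + t * (v x' * inner ℝ (f x) u + v x * inner ℝ (f x') u) +
        t ^ 2 * ‖u‖ ^ 2 * (v x * v x') := by
    intro x x'
    simp only [inner_add_left, inner_add_right, real_inner_smul_left, real_inner_smul_right,
      real_inner_self_eq_norm_sq, real_inner_comm (f x') u]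
    ring
  simp only [gramLoss, key, mul_sum, sum_mul, ← sum_add_distrib]
  refine sum_congr rfl fun x _ => sum_congr rfl fun x' _ => ?_
  ring

variable {G : Matrix X X ℝ} {f : X → E}

/-- First-order condition: with `f` as a matrix with rows `f x`, this is `f fᵀ f = G f` paired with
`v` and `u`. -/
theorem sum_mul_inner_eq_of_gramLoss_le (hG : ∀ x x', G x x' = G x' x)
    (hf : ∀ h : X → E, gramLoss G f ≤ gramLoss G h) (v : X → ℝ) (u : E) :
    ∑ x, ∑ x', inner ℝ (f x) (f x') * v x * inner ℝ (f x') u =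
      ∑ x, ∑ x', G x x' * v x * inner ℝ (f x') u := by
  have h0 := linear_coeff_eq_zero_of_nonneg fun t => by
    have := hf fun x => f x + (t * v x) • u
    rw [gramLoss_add_smul] at this
    exact nonneg_of_le_add_right this
  have hs : ∑ x, ∑ x', 2 * (inner ℝ (f x) (f x') - G x x') * (v x' * inner ℝ (f x) u) =
      ∑ x, ∑ x', 2 * (inner ℝ (f x) (f x') - G x x') * (v x * inner ℝ (f x') u) := by
    rw [sum_comm]
    refine sum_congr rfl fun x _ => sum_congr rfl fun x' _ => ?_
    rw [hG x' x, real_inner_comm]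
  simp only [mul_add, sum_add_distrib] at h0
  rw [hs, ← two_mul] at h0
  rw [← sub_eq_zero]
  have h1 : ∑ x, ∑ x', 2 * (inner ℝ (f x) (f x') - G x x') * (v x * inner ℝ (f x') u) =
      2 * (∑ x, ∑ x', inner ℝ (f x) (f x') * v x * inner ℝ (f x') u -
        ∑ x, ∑ x', G x x' * v x * inner ℝ (f x') u) := by
    simp only [mul_sum, ← sum_sub_distrib]
    refine sum_congr rfl fun x _ => sum_congr rfl fun x' _ => ?_
    ring
  linarith

/-- Second-order condition in a direction `v` that the features miss: `fᵀ v = 0` removes the Gram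
part and the cross term, leaving a comparison of `G` at `v` with the second moment of `f` at `u`. -/
theorem mul_quadratic_le_of_gramLoss_le (hf : ∀ h : X → E, gramLoss G f ≤ gramLoss G h) {v : X → ℝ} (hv : ∑ x, v x • f x = 0) (u : E) :
    ‖u‖ ^ 2 * ∑ x, ∑ x', G x x' * (v x * v x') ≤
      (∑ x, v x ^ 2) * ∑ x, (inner ℝ (f x) u) ^ 2 := by
  have hv' : ∀ z : E, ∑ x, v x * inner ℝ (f x) z = 0 := by
    intro z
    have := congrArg (fun y => inner ℝ y z) hv
    simpa [sum_inner, real_inner_smul_left] using this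
  have hexp := fun t : ℝ => by
    have := hf fun x => f x + (t * v x) • u
    rw [gramLoss_add_smul] at this
    exact nonneg_of_le_add_right this
  have h1 := linear_coeff_eq_zero_of_nonneg hexp
  rw [h1] at hexp
  have h2 := quadratic_coeff_nonneg_of_nonneg fun t => by simpa using hexp t
  have hK : ∑ x, ∑ x', inner ℝ (f x) (f x') * (v x * v x') = 0 := by
    refine sum_eq_zero fun x _ => ?_
    have := hv' (f x)
    calc _ = v x * ∑ x', v x' * inner ℝ (f x') (f x) := by
          rw [mul_sum]
          refine sum_congr rfl fun x' _ => ?_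
          rw [real_inner_comm]; ring
      _ = 0 := by rw [this, mul_zero]
  have hc : ∑ x, ∑ x', (v x * inner ℝ (f x) u) * (v x' * inner ℝ (f x') u) = 0 := by
    simp only [← mul_sum, hv' u, mul_zero, sum_const_zero]
  have ha : ∑ x, ∑ x', v x' ^ 2 * (inner ℝ (f x) u) ^ 2 =
      (∑ x, v x ^ 2) * ∑ x, (inner ℝ (f x) u) ^ 2 := by
    rw [sum_mul_sum, sum_comm]
  have hb : ∑ x, ∑ x', v x ^ 2 * (inner ℝ (f x') u) ^ 2 =
      (∑ x, v x ^ 2) * ∑ x, (inner ℝ (f x) u) ^ 2 := by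
    rw [sum_mul_sum]
  have h3 : ∑ x, ∑ x', (2 * ‖u‖ ^ 2 * (inner ℝ (f x) (f x') - G x x') * (v x * v x') +
          (v x' * inner ℝ (f x) u + v x * inner ℝ (f x') u) ^ 2) =
      2 * ‖u‖ ^ 2 * (∑ x, ∑ x', inner ℝ (f x) (f x') * (v x * v x')) -
      2 * ‖u‖ ^ 2 * (∑ x, ∑ x', G x x' * (v x * v x')) +
      ∑ x, ∑ x', v x' ^ 2 * (inner ℝ (f x) u) ^ 2 +
      ∑ x, ∑ x', v x ^ 2 * (inner ℝ (f x') u) ^ 2 +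
      2 * ∑ x, ∑ x', (v x * inner ℝ (f x) u) * (v x' * inner ℝ (f x') u) := by
    simp only [mul_sum, ← sum_sub_distrib, ← sum_add_distrib]
    refine sum_congr rfl fun x _ => sum_congr rfl fun x' _ => ?_
    ring
  rw [h3, hK, hc, ha, hb] at h2
  linarith

variable [DecidableEq Y] {π : X → Y}

theorem sum_mul_comp_eq [Fintype Y] (w : X → ℝ) (φ : Y → ℝ) :
    ∑ x, w x * φ (π x) = ∑ c, (∑ x, if π x = c then w x else 0) * φ c := by
  simp only [sum_mul, ite_mul, zero_mul]
  rw [sum_comm]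
  simp

/-- The similarity matrix of a blocked dataset: an additional weight on the diagonal, a weight on
pairs of the same block, and a weight on all pairs. -/
def blockMatrix [DecidableEq X] (π : X → Y) (a b e : ℝ) : Matrix X X ℝ :=
  fun x x' => (if x = x' then a else 0) + (if π x = π x' then b else 0) + e

omit [Fintype X] in
theorem blockMatrix_comm [DecidableEq X] (π : X → Y) (a b e : ℝ) (x x' : X) :
    blockMatrix π a b e x x' = blockMatrix π a b e x' x := by
  simp only [blockMatrix, eq_comm]

theorem sum_blockMatrix_mul [DecidableEq X] (a b e : ℝ) (w : X → ℝ) (x' : X) :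
    ∑ x, blockMatrix π a b e x x' * w x =
      a * w x' + b * (∑ x, if π x = π x' then w x else 0) + e * ∑ x, w x := by
  simp only [blockMatrix, add_mul, ite_mul, zero_mul, sum_add_distrib, mul_sum, mul_ite, mul_zero]
  simp

/-- The features of a global minimizer of the Gram loss of a block matrix represent linearly every
function that is constant on blocks, if their dimension is at least the number of
blocks. -/
theorem exists_inner_eq_comp_of_gramLoss_le [Fintype Y] [DecidableEq X]
    [FiniteDimensional ℝ E]
    {a b e : ℝ} (ha : 0 ≤ a) (hb : 0 < b) (he : 0 ≤ e)
    (hcard : Fintype.card Y ≤ Module.finrank ℝ E)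
    (hf : ∀ h : X → E, gramLoss (blockMatrix π a b e) f ≤ gramLoss (blockMatrix π a b e) h)
    (φ : Y → ℝ) : ∃ u : E, ∀ x, inner ℝ (f x) u = φ (π x) := by
  -- The contradiction hypothesis supplies the missed direction: a vector `v` orthogonal to all
  -- linear readouts of `f` but not to `φ ∘ π`.
  by_contra hne
  let T : E →ₗ[ℝ] EuclideanSpace ℝ X :=
    { toFun := fun u => WithLp.toLp 2 fun x => inner ℝ (f x) u
      map_add' := fun u u' => by ext x; simp [inner_add_right]
      map_smul' := fun t u => by ext x; simp [real_inner_smul_right] }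
  have hmem : (WithLp.toLp 2 fun x => φ (π x) : EuclideanSpace ℝ X) ∉ (LinearMap.range T)ᗮᗮ := by
    rw [Submodule.orthogonal_orthogonal]
    rintro ⟨u, hu⟩
    exact hne ⟨u, fun x => congrArg (fun z : EuclideanSpace ℝ X => z x) hu⟩
  rw [Submodule.mem_orthogonal] at hmem
  push Not at hmem
  obtain ⟨v, hv, hvφ⟩ := hmem
  have hvf : ∑ x, v x • f x = 0 := by
    rw [← inner_self_eq_zero (𝕜 := ℝ), sum_inner]
    have := (Submodule.mem_orthogonal _ _).1 hv _ ⟨∑ x, v x • f x, rfl⟩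
    simp only [T, PiLp.inner_apply, LinearMap.coe_mk, AddHom.coe_mk] at this
    rw [← this]
    exact sum_congr rfl fun x _ => by simp [real_inner_smul_left]
  have hvφ' : ∑ x, v x * φ (π x) ≠ 0 := by
    simpa [PiLp.inner_apply, mul_comm] using hvφ
  -- Some block sum of `v` is nonzero, so the quadratic form of the block matrix at `v` strictly
  -- exceeds `a * ∑ x, v x ^ 2`.
  have hsum : 0 < ∑ c, (∑ x, if π x = c then v x else 0) ^ 2 := by
    refine lt_of_le_of_ne (by positivity) fun h0 => hvφ' ?_
    rw [sum_mul_comp_eq]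
    refine sum_eq_zero fun c _ => ?_
    have := (sum_eq_zero_iff_of_nonneg fun c _ => sq_nonneg _).1 h0.symm c (mem_univ c)
    rw [pow_eq_zero_iff two_ne_zero] at this
    rw [this, zero_mul]
  have hquad : ∑ x, ∑ x', blockMatrix π a b e x x' * (v x * v x') =
      a * ∑ x, v x ^ 2 + b * ∑ c, (∑ x, if π x = c then v x else 0) ^ 2 +
        e * (∑ x, v x) ^ 2 := by
    have h1 : ∑ c, (∑ x, if π x = c then v x else 0) ^ 2 =
        ∑ x', v x' * ∑ x, if π x = π x' then v x else 0 := by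
      rw [sum_mul_comp_eq v fun c => ∑ x, if π x = c then v x else 0]
      simp only [sq]
    rw [sum_comm, h1, sq (∑ x, v x), mul_sum, mul_sum, mul_sum, mul_sum, ← sum_add_distrib,
      ← sum_add_distrib]
    refine sum_congr rfl fun x' _ => ?_
    have := sum_blockMatrix_mul (π := π) a b e v x'
    calc _ = (∑ x, blockMatrix π a b e x x' * v x) * v x' := by
          rw [sum_mul]; exact sum_congr rfl fun x _ => by ring
      _ = _ := by rw [this]; ring
  -- Hence the second moment of the features exceeds `a` in every direction.
  have hsecond : ∀ u : E, (∑ x, (inner ℝ (f x) u) ^ 2) ≤ a * ‖u‖ ^ 2 → u = 0 := by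
    intro u hu
    have h1 := mul_quadratic_le_of_gramLoss_le hf hvf u
    rw [hquad] at h1
    have h2 : (∑ x, v x ^ 2) * ∑ x, (inner ℝ (f x) u) ^ 2 ≤ (∑ x, v x ^ 2) * (a * ‖u‖ ^ 2) :=
      mul_le_mul_of_nonneg_left hu (by positivity)
    have h3 : 0 ≤ ‖u‖ ^ 2 * (e * (∑ x, v x) ^ 2) := by positivity
    have h4 : ‖u‖ ^ 2 * (b * ∑ c, (∑ x, if π x = c then v x else 0) ^ 2) ≤ 0 := by linarith
    have h5 : ‖u‖ ^ 2 ≤ 0 := nonpos_of_mul_nonpos_left h4 (mul_pos hb hsum)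
    simpa using le_antisymm h5 (by positivity)
  -- Vectors with zero block sums are eigenvectors of the block matrix for `a`. For `z = fᵀ w` the
  -- first-order condition then makes the second moment at `z` equal to `a * ‖z‖ ^ 2`, so `hsecond`
  -- forces `z = 0`.
  have horth : ∀ w : X → ℝ, (∀ c, (∑ x, if π x = c then w x else 0) = 0) →
      ∑ x, w x • f x = 0 := by
    intro w hw
    have hw1 : ∑ x, w x = 0 := by
      have := sum_mul_comp_eq (π := π) w fun _ => 1
      simpa [hw] using this
    refine hsecond _ ?_
    set z := ∑ x, w x • f x with hz
    have h1 := sum_mul_inner_eq_of_gramLoss_le (blockMatrix_comm π a b e) hf w z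
    rw [sum_comm] at h1
    nth_rewrite 2 [sum_comm] at h1
    have h2 : ∀ x', ∑ x, inner ℝ (f x) (f x') * w x * inner ℝ (f x') z =
        (inner ℝ (f x') z) ^ 2 := by
      intro x'
      rw [← sum_mul, sq]
      congr 1
      rw [real_inner_comm, hz, sum_inner]
      exact sum_congr rfl fun x _ => by rw [real_inner_smul_left, mul_comm]
    have h3 : ∀ x', ∑ x, blockMatrix π a b e x x' * w x * inner ℝ (f x') z =
        a * (w x' * inner ℝ (f x') z) := by
      intro x'
      rw [← sum_mul, sum_blockMatrix_mul, hw, hw1]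
      ring
    simp only [h2, h3] at h1
    rw [h1, ← mul_sum, ← real_inner_self_eq_norm_sq]
    nth_rewrite 2 [hz]
    rw [sum_inner]
    simp only [real_inner_smul_left, le_refl]
  let K : E →ₗ[ℝ] (Y → ℝ) :=
    { toFun := fun u c => ∑ x, if π x = c then inner ℝ (f x) u else 0
      map_add' := fun u u' => by
        ext c
        simp only [inner_add_right, Pi.add_apply, ← sum_add_distrib]
        exact sum_congr rfl fun x _ => by split_ifs <;> simp
      map_smul' := fun t u => by
        ext c
        simp only [real_inner_smul_right, Pi.smul_apply, RingHom.id_apply, smul_eq_mul, mul_sum,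
          mul_ite, mul_zero] }
  -- A readout with zero block sums is orthogonal to itself by `horth`, so it vanishes. The
  -- dimension assumption then makes `K` bijective.
  have hK : Function.Injective K := by
    rw [← LinearMap.ker_eq_bot, LinearMap.ker_eq_bot']
    intro u hu
    have h1 := horth (fun x => inner ℝ (f x) u) fun c => congrFun hu c
    have h2 : ∑ x, (inner ℝ (f x) u) ^ 2 = 0 := by
      have := congrArg (fun y => inner ℝ y u) h1
      simpa [sum_inner, real_inner_smul_left, sq] using this
    exact hsecond u (by rw [h2]; positivity)
  have hdim : Module.finrank ℝ E = Module.finrank ℝ (Y → ℝ) := by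
    refine le_antisymm (LinearMap.finrank_le_finrank_of_injective hK) ?_
    rwa [Module.finrank_fintype_fun_eq_card]
  obtain ⟨u, hu⟩ := (LinearMap.injective_iff_surjective_of_finrank_eq_finrank hdim).1 hK
    fun c => ∑ x, if π x = c then φ (π x) else 0
  have hw : ∀ c, (∑ x, if π x = c then inner ℝ (f x) u - φ (π x) else 0) = 0 := by
    intro c
    have := congrFun hu c
    rw [← sub_eq_zero] at this
    refine Eq.trans ?_ this
    simp only [K, LinearMap.coe_mk, AddHom.coe_mk, ← sum_sub_distrib]
    exact sum_congr rfl fun x _ => by split_ifs <;> simp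
  -- The readout at `u` matches the block sums of `φ ∘ π`; their difference is orthogonal to both,
  -- hence zero.
  have h1 : ∑ x, (inner ℝ (f x) u - φ (π x)) * inner ℝ (f x) u = 0 := by
    have := congrArg (fun y => inner ℝ y u) (horth _ hw)
    simpa [sum_inner, real_inner_smul_left] using this
  have h2 : ∑ x, (inner ℝ (f x) u - φ (π x)) * φ (π x) = 0 := by
    rw [sum_mul_comp_eq]
    simp [hw]
  have h3 : ∑ x, (inner ℝ (f x) u - φ (π x)) ^ 2 = 0 := by
    rw [← sub_zero (0 : ℝ)]
    nth_rewrite 1 [← h1]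
    rw [← h2, ← sum_sub_distrib]
    exact sum_congr rfl fun x _ => by ring
  refine hne ⟨u, fun x => ?_⟩
  have := (sum_eq_zero_iff_of_nonneg fun x _ => sq_nonneg _).1 h3 x (mem_univ x)
  rw [pow_eq_zero_iff two_ne_zero] at this
  linarith

end GramLoss

/-! ### Majority labels -/

/-- If labels that disagree in many pairs of one block, or in many pairs of samples, are replaced by
the majority label of the block, few labels change. -/
theorem exists_majority_card_le {X C Y : Type*} [Fintype X] [DecidableEq X] [Fintype C]
    [DecidableEq C] [Fintype Y] [DecidableEq Y] [Nonempty Y] (π : X → C) (g : X → Y) {m : ℕ}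
    (hm : ∀ c, #{x | π x = c} = m) {a b e : ℝ} (hb : 0 ≤ b) (he : 0 ≤ e) :
    ∃ L : C → Y, (b * m + e * Fintype.card X) * #{x | L (π x) ≠ g x} ≤
      ∑ x, ∑ x', if g x ≠ g x' then blockMatrix π a b e x x' else 0 := by
  have hmin : ∀ c, ∃ i, ∀ j, #{x | π x = c ∧ i ≠ g x} ≤ #{x | π x = c ∧ j ≠ g x} := by
    intro c
    obtain ⟨i, -, hi⟩ := exists_min_image univ (fun i => #{x | π x = c ∧ i ≠ g x})
      univ_nonempty
    exact ⟨i, fun j => hi j (mem_univ j)⟩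
  choose L hL using hmin
  have hfib : ∀ q : X → Prop, [DecidablePred q] →
      #{x | q x} = ∑ c, #{x | π x = c ∧ q x} := by
    intro q _
    rw [card_eq_sum_card_fiberwise (f := π) (t := univ) (fun _ _ => by simp)]
    refine sum_congr rfl fun c _ => ?_
    rw [filter_filter]
    simp only [and_comm]
  have hbad : #{x | L (π x) ≠ g x} = ∑ c, #{x | π x = c ∧ L c ≠ g x} := by
    rw [hfib]
    refine sum_congr rfl fun c _ => congrArg card (filter_congr fun x _ => ?_)
    constructor
    · rintro ⟨rfl, h⟩; exact ⟨rfl, h⟩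
    · rintro ⟨rfl, h⟩; exact ⟨rfl, h⟩
  -- Any label `g x`, used for a whole block, errs there at least as often as the majority label;
  -- `hall` applies this to all blocks at once.
  have hsame : m * #{x | L (π x) ≠ g x} ≤ ∑ x, #{x' | π x' = π x ∧ g x ≠ g x'} := by
    calc m * #{x | L (π x) ≠ g x}
        = ∑ c, ∑ x ∈ {x | π x = c}, #{x' | π x' = π x ∧ L (π x) ≠ g x'} := by
          rw [hbad, mul_sum]
          refine sum_congr rfl fun c _ => ?_
          rw [← hm c, ← smul_eq_mul, ← sum_const]
          refine sum_congr rfl fun x hx => ?_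
          rw [(mem_filter.1 hx).2]
      _ = ∑ x, #{x' | π x' = π x ∧ L (π x) ≠ g x'} :=
          sum_fiberwise_of_maps_to (fun _ _ => mem_univ _) _
      _ ≤ _ := sum_le_sum fun x _ => hL (π x) (g x)
  have hall : Fintype.card X * #{x | L (π x) ≠ g x} ≤ ∑ x, #{x' | g x ≠ g x'} := by
    rw [← card_univ, ← smul_eq_mul, ← sum_const]
    refine sum_le_sum fun x _ => ?_
    rw [hbad, hfib]
    exact sum_le_sum fun c _ => hL c (g x)
  refine ⟨L, ?_⟩
  -- Disagreeing samples are distinct, so the diagonal weight `a` never counts.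
  have hle : ∀ x x', b * (if π x' = π x ∧ g x ≠ g x' then 1 else 0) +
      e * (if g x ≠ g x' then 1 else 0) ≤
      if g x ≠ g x' then blockMatrix π a b e x x' else 0 := by
    intro x x'
    by_cases hg : g x = g x'
    · simp [hg]
    · have hx : x ≠ x' := fun h => hg (congrArg g h)
      by_cases hp : π x = π x'
      · simp [blockMatrix, hg, hp, hx]
      · simp [blockMatrix, hg, hp, Ne.symm hp, hx]
  refine le_trans ?_ (sum_le_sum fun x _ => sum_le_sum fun x' _ => hle x x')
  simp only [sum_add_distrib, ← mul_sum]
  have h1 : ((m * #{x | L (π x) ≠ g x} : ℕ) : ℝ) ≤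
      ((∑ x, #{x' | π x' = π x ∧ g x ≠ g x'} : ℕ) : ℝ) := Nat.cast_le.2 hsame
  have h2 : ((Fintype.card X * #{x | L (π x) ≠ g x} : ℕ) : ℝ) ≤
      ((∑ x, #{x' | g x ≠ g x'} : ℕ) : ℝ) := Nat.cast_le.2 hall
  push_cast [card_filter] at h1 h2 ⊢
  have h3 := mul_le_mul_of_nonneg_left h1 hb
  have h4 := mul_le_mul_of_nonneg_left h2 he
  linarith

/-! ### Augmentation graph and joint law -/

namespace ContrastiveModel

variable {Xbar X Y : Type*} [MeasurableSpace Xbar] [MeasurableSpace X] [MeasurableSpace Y]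
  (M : ContrastiveModel Xbar X Y)

theorem measurable_aug_real {s : Set X} (hs : MeasurableSet s) :
    Measurable fun xbar => (M.aug xbar).real s :=
  (M.aug.measurable_coe hs).ennreal_toReal

theorem aug_real_le_one (xbar : Xbar) (s : Set X) : (M.aug xbar).real s ≤ 1 := by
  have := M.isMarkovKernel_aug
  exact measureReal_le_one

theorem integrable_of_mem_Icc {φ : Xbar → ℝ} (hφ : Measurable φ) (h0 : ∀ z, 0 ≤ φ z)
    (h1 : ∀ z, φ z ≤ 1) : Integrable φ M.natural := by
  have := M.isProbabilityMeasure_natural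
  refine Integrable.of_bound hφ.aestronglyMeasurable 1 (Filter.Eventually.of_forall fun z => ?_)
  rw [Real.norm_of_nonneg (h0 z)]
  exact h1 z

theorem joint_real {s : Set (Xbar × X)} (hs : MeasurableSet s) :
    M.joint.real s = ∫ xbar, (M.aug xbar).real (Prod.mk xbar ⁻¹' s) ∂M.natural := by
  have := M.isProbabilityMeasure_natural
  have := M.isMarkovKernel_aug
  rw [measureReal_def, joint, Measure.compProd_apply hs]
  exact (integral_toReal (Kernel.measurable_kernel_prodMk_left hs).aemeasurable
    (Filter.Eventually.of_forall fun _ => measure_lt_top _ _)).symm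

instance : IsProbabilityMeasure M.joint := by
  have := M.isProbabilityMeasure_natural
  have := M.isMarkovKernel_aug
  unfold joint
  infer_instance

variable [Fintype X] [MeasurableSingletonClass X]

theorem aug_real_eq_sum (xbar : Xbar) (q : X → Prop) [DecidablePred q] :
    (M.aug xbar).real {x | q x} = ∑ x, if q x then (M.aug xbar).real {x} else 0 := by
  have := M.isMarkovKernel_aug
  rw [← sum_filter, sum_measureReal_singleton]
  simp

theorem sum_aug_real (xbar : Xbar) : ∑ x, (M.aug xbar).real {x} = 1 := by
  have := M.isMarkovKernel_aug
  rw [sum_measureReal_singleton]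
  simp

omit [Fintype X] in
theorem integrable_aug_mul_aug (x x' : X) :
    Integrable (fun xbar => (M.aug xbar).real {x} * (M.aug xbar).real {x'}) M.natural :=
  M.integrable_of_mem_Icc
    ((M.measurable_aug_real (measurableSet_singleton x)).mul
      (M.measurable_aug_real (measurableSet_singleton x')))
    (fun _ => by positivity)
    (fun z => mul_le_one₀ (M.aug_real_le_one z _) (by positivity) (M.aug_real_le_one z _))

omit [Fintype X] in
theorem integrable_aug (x : X) : Integrable (fun xbar => (M.aug xbar).real {x}) M.natural :=
  M.integrable_of_mem_Icc (M.measurable_aug_real (measurableSet_singleton x))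
    (fun _ => by positivity) (fun z => M.aug_real_le_one z _)

theorem vertexWeight_eq_integral (x : X) :
    M.vertexWeight x = ∫ xbar, (M.aug xbar).real {x} ∂M.natural := by
  simp only [vertexWeight, weight]
  rw [← integral_finsetSum _ fun x' _ => M.integrable_aug_mul_aug x x']
  simp only [← mul_sum, sum_aug_real, mul_one]

theorem joint_real_snd (q : X → Prop) [DecidablePred q] :
    M.joint.real {p | q p.2} = ∑ x, if q x then M.vertexWeight x else 0 := by
  have hs : MeasurableSet {p : Xbar × X | q p.2} :=
    measurable_snd (Set.toFinite {x | q x}).measurableSet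
  rw [M.joint_real hs]
  simp only [Set.preimage_ofPred_eq, aug_real_eq_sum]
  rw [integral_finsetSum _ fun x _ => ?_]
  · refine sum_congr rfl fun x _ => ?_
    split_ifs
    · rw [vertexWeight_eq_integral]
    · simp
  · split_ifs
    · exact M.integrable_aug x
    · simp

variable [DecidableEq Y] [MeasurableSingletonClass Y] [Countable Y]

omit [DecidableEq Y] in
theorem measurableSet_ne_label (g : X → Y) :
    MeasurableSet {p : Xbar × X | g p.2 ≠ M.label p.1} := by
  have hg : Measurable g := measurable_of_countable g
  exact (measurableSet_eq_fun (hg.comp measurable_snd)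
    (M.measurable_label.comp measurable_fst)).compl

/-- A classifier disagrees on a positive pair with at most twice its error probability. -/
theorem sum_weight_ne_le (g : X → Y) :
    ∑ x, ∑ x', (if g x ≠ g x' then M.weight x x' else 0) ≤
      2 * M.joint.real {p | g p.2 ≠ M.label p.1} := by
  have hs := M.measurableSet_ne_label g
  have h1 : ∀ x x', (if g x ≠ g x' then M.weight x x' else 0) =
      ∫ xbar, (if g x ≠ g x' then (M.aug xbar).real {x} * (M.aug xbar).real {x'} else 0)
        ∂M.natural := by
    intro x x'
    split_ifs <;> simp [weight]
  have hint : ∀ x x', Integrable (fun xbar =>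
      (if g x ≠ g x' then (M.aug xbar).real {x} * (M.aug xbar).real {x'} else 0)) M.natural := by
    intro x x'
    split_ifs
    · exact M.integrable_aug_mul_aug x x'
    · simp
  simp only [h1]
  simp only [← integral_finsetSum _ fun x' _ => hint _ x']
  rw [← integral_finsetSum _ fun x _ => integrable_finsetSum _ fun x' _ => hint x x',
    M.joint_real hs, ← integral_const_mul]
  refine integral_mono (integrable_finsetSum _ fun x _ => integrable_finsetSum _ fun x' _ =>
    hint x x') (Integrable.const_mul (M.integrable_of_mem_Icc ?_ (fun _ => by positivity)
      fun z => M.aug_real_le_one z _) _) fun z => ?_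
  · have := M.isMarkovKernel_aug
    exact (Kernel.measurable_kernel_prodMk_left hs).ennreal_toReal
  simp only [Set.preimage_ofPred_eq, aug_real_eq_sum]
  -- If `g x ≠ g x'`, at least one of them differs from the label of `z`.
  calc _ ≤ ∑ x, ∑ x', ((if g x ≠ M.label z then (M.aug z).real {x} else 0) * (M.aug z).real {x'} +
        (M.aug z).real {x} * (if g x' ≠ M.label z then (M.aug z).real {x'} else 0)) := by
        refine sum_le_sum fun x _ => sum_le_sum fun x' _ => ?_
        have h0 : 0 ≤ (M.aug z).real {x} * (M.aug z).real {x'} := by positivity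
        split_ifs with h h2 h3 h3 h2 h3 h3 <;> simp_all
    _ = _ := by
        simp only [sum_add_distrib, ← mul_sum, ← sum_mul, sum_aug_real]
        ring

end ContrastiveModel

/-! ### The easy subset and the probing bound -/

theorem similarityMatrix_submatrix_eq_blockMatrix {r n : ℕ} (D : Finset (Fin (r + 1) × Fin n))
    (α β γ : ℝ) :
    (similarityMatrix D α β γ).submatrix Subtype.val Subtype.val =
      blockMatrix (fun x : EasySample D => x.1.1) (1 - α) (α - β) β := by
  ext x x'
  simp only [Matrix.submatrix_apply, similarityMatrix, blockMatrix, x.2, false_and, if_false,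
    Subtype.val_inj]
  by_cases h : x = x'
  · simp [h]
  · by_cases h' : x.1.1 = x'.1.1 <;> simp [h, h']

theorem card_easySample_class {r n nd : ℕ} {D : Finset (Fin (r + 1) × Fin n)}
    (hD : ∀ i : Fin (r + 1), (Finset.univ.filter fun j : Fin n => (i, j) ∈ D).card = nd)
    (c : Fin (r + 1)) : #{x : EasySample D | x.1.1 = c} = n - nd := by
  have h1 : #{x : EasySample D | x.1.1 = c} = #{j : Fin n | (c, j) ∉ D} := by
    refine card_bij (fun x _ => x.1.2) ?_ ?_ ?_
    · rintro ⟨⟨i, j⟩, hx⟩ h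
      obtain rfl : i = c := by simpa using h
      simpa using hx
    · rintro ⟨⟨i, j⟩, hx⟩ h ⟨⟨i', j'⟩, hx'⟩ h' hj
      obtain rfl : i = c := by simpa using h
      obtain rfl : i' = i := by simpa using h'
      simp_all
    · intro j hj
      exact ⟨⟨(c, j), by simpa using hj⟩, by simp, rfl⟩
  have h2 := card_filter_add_card_filter_not (s := (univ : Finset (Fin n))) fun j => (c, j) ∈ D
  rw [hD c, card_univ, Fintype.card_fin] at h2
  omega

theorem corollary1 {r n nd k : ℕ} {α β γ δ : ℝ}
    (hβ : 0 ≤ β) (hβγ : β < γ) (hγα : γ < α) (hα : α < 1)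
    (hnd : nd < n) (hk : r < k)
    (D : Finset (Fin (r + 1) × Fin n))
    (hD : ∀ i : Fin (r + 1), (Finset.univ.filter fun j : Fin n => (i, j) ∈ D).card = nd)
    {Xbar : Type*} [MeasurableSpace Xbar]
    (M : ContrastiveModel Xbar (EasySample D) (Fin (r + 1)))
    (hM : M.HasSimilarityGraph
      ((similarityMatrix D α β γ).submatrix Subtype.val Subtype.val))
    (hδ : M.LabelsRecoverable δ)
    (F : Set (EasySample D → EuclideanSpace ℝ (Fin k)))
    (hF : M.Realizable F)
    (f : EasySample D → EuclideanSpace ℝ (Fin k))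
    (hf : M.IsTrained F f) :
    M.linearProbingError f ≤
      4 * δ / (1 - (1 - α) / ((1 - α) + ((n : ℝ) - nd) * α + ((n : ℝ) - nd) * r * β))
        + 8 * δ := by
  set π : EasySample D → Fin (r + 1) := fun x => x.1.1 with hπ
  have hclass : ∀ c, #{x | π x = c} = n - nd := card_easySample_class hD
  have hm : ((n - nd : ℕ) : ℝ) = (n : ℝ) - nd := Nat.cast_sub hnd.le
  set m : ℝ := (n : ℝ) - nd with hm_def
  have hm0 : 0 < m := by
    have : (nd : ℝ) < n := Nat.cast_lt.2 hnd
    linarith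
  set N : ℝ := (Fintype.card (EasySample D) : ℝ) with hN
  have hNm : N = (r + 1) * m := by
    have h := card_eq_sum_card_fiberwise (f := π) (s := univ) (t := univ) (fun _ _ => by simp)
    simp only [hclass, sum_const, card_univ, Fintype.card_fin, smul_eq_mul] at h
    rw [hN, h, Nat.cast_mul, hm]
    push_cast
    ring
  have hN0 : 0 < N := by rw [hNm]; positivity
  set d : ℝ := (1 - α) + m * α + m * r * β with hd
  -- `ρ` is the factor from the majority lemma; it is the row sum `d` less `1 - α`.
  set ρ : ℝ := (α - β) * m + β * N with hρ
  have hρ' : ρ = m * α + m * r * β := by rw [hρ, hNm]; ring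
  have hρ0 : 0 < ρ := by
    rw [hρ']
    have : 0 < m * α := mul_pos hm0 (by linarith)
    have : 0 ≤ m * r * β := by positivity
    linarith
  have hdρ : d = (1 - α) + ρ := by rw [hρ', hd]; ring
  have hd0 : 0 < d := by linarith
  set S := blockMatrix π (1 - α) (α - β) β with hS
  have hcol : ∀ x', ∑ x, S x x' = d := by
    intro x'
    have h := sum_blockMatrix_mul (π := π) (1 - α) (α - β) β (fun _ => 1) x'
    have h2 : (∑ x, if π x = π x' then (1 : ℝ) else 0) = m := by
      rw [← hm, ← hclass (π x'), card_filter]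
      push_cast
      rfl
    rw [h2] at h
    simp only [mul_one, sum_const, card_univ, nsmul_eq_mul] at h
    rw [h, hdρ, hρ]
    ring
  have htotal : ∑ x, ∑ x', S x x' = N * d := by
    calc _ = ∑ x', ∑ x, S x x' := sum_comm
      _ = _ := by simp [hcol, hN]
  have hweight : ∀ x x', M.weight x x' = S x x' / (N * d) := by
    intro x x'
    have h := hM x x'
    rw [similarityMatrix_submatrix_eq_blockMatrix] at h
    rw [h, ← htotal]
  have hvertex : ∀ x, M.vertexWeight x = 1 / N := by
    intro x
    have : ∑ x', S x x' = d := by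
      rw [← hcol x]
      exact sum_congr rfl fun x' _ => blockMatrix_comm _ _ _ _ _ _
    simp only [ContrastiveModel.vertexWeight, hweight, ← sum_div, this]
    field_simp
  -- The vertex weights are `1 / N`, so the factor `N ^ 2` normalizes the quartic part and scales
  -- the similarities by `N / d`.
  have hloss : ∀ h : EasySample D → EuclideanSpace ℝ (Fin k), N ^ 2 * M.spectralLoss h =
      gramLoss (blockMatrix π (N / d * (1 - α)) (N / d * (α - β)) (N / d * β)) h := by
    intro h
    simp only [ContrastiveModel.spectralLoss, gramLoss, hweight, hvertex, mul_add, mul_sum]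
    congr 1 <;> refine sum_congr rfl fun x _ => sum_congr rfl fun x' _ => ?_
    · have : blockMatrix π (N / d * (1 - α)) (N / d * (α - β)) (N / d * β) x x' =
          N / d * S x x' := by
        simp only [hS, blockMatrix, mul_add, mul_ite, mul_zero]
      rw [this]
      field_simp
    · field_simp
  have hglobal : ∀ h : EasySample D → EuclideanSpace ℝ (Fin k),
      gramLoss (blockMatrix π (N / d * (1 - α)) (N / d * (α - β)) (N / d * β)) f ≤
        gramLoss (blockMatrix π (N / d * (1 - α)) (N / d * (α - β)) (N / d * β)) h := by
    intro h
    obtain ⟨f₀, hf₀, hmin⟩ := hF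
    rw [← hloss, ← hloss]
    exact mul_le_mul_of_nonneg_left ((hf.2 f₀ hf₀).trans (hmin h)) (by positivity)
  have hNd : 0 < N / d := div_pos hN0 hd0
  have hspan := exists_inner_eq_comp_of_gramLoss_le (π := π)
    (mul_nonneg hNd.le (by linarith)) (mul_pos hNd (by linarith)) (mul_nonneg hNd.le hβ)
    (by simpa using hk) hglobal
  obtain ⟨g, hg⟩ := hδ
  have herr : M.joint.real {p | g p.2 ≠ M.label p.1} ≤ δ := by
    have h := measureReal_compl (μ := M.joint) (M.measurableSet_ne_label g)
    have h' : {p : Xbar × EasySample D | g p.2 ≠ M.label p.1}ᶜ = {p | g p.2 = M.label p.1} := by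
      ext p; simp
    rw [h', probReal_univ] at h
    linarith
  have hδ0 : 0 ≤ δ := le_trans (by positivity) herr
  obtain ⟨L, hL⟩ := exists_majority_card_le π g hclass (a := 1 - α) (b := α - β) (e := β)
    (by linarith) hβ
  have hdis : ∑ x, ∑ x', (if g x ≠ g x' then S x x' else 0) ≤ N * d * (2 * δ) := by
    have h := (M.sum_weight_ne_le g).trans (mul_le_mul_of_nonneg_left herr zero_le_two)
    calc _ = N * d * ∑ x, ∑ x', (if g x ≠ g x' then M.weight x x' else 0) := by
          simp only [mul_sum, mul_ite, mul_zero, hweight]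
          refine sum_congr rfl fun x _ => sum_congr rfl fun x' _ => ?_
          field_simp
      _ ≤ _ := mul_le_mul_of_nonneg_left h (by positivity)
  have hmajority : M.joint.real {p | L (π p.2) ≠ g p.2} ≤ 2 * δ * d / ρ := by
    rw [M.joint_real_snd fun x => L (π x) ≠ g x]
    simp only [hvertex]
    rw [← sum_filter, sum_const, nsmul_eq_mul, le_div_iff₀ hρ0]
    rw [hm] at hL
    have h := hL.trans hdis
    calc _ = ρ * #{x | L (π x) ≠ g x} / N := by ring
      _ ≤ N * d * (2 * δ) / N := div_le_div_of_nonneg_right h hN0.le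
      _ = 2 * δ * d := by field_simp
  -- Row `i` of the probe reads out the indicator of the classes with majority label `i`, so its
  -- argmax is unique.
  choose B hB using fun i => hspan fun c => if L c = i then 1 else 0
  have hprobe : M.linearProbingError f ≤ M.probeError f (Matrix.of fun i j => B i j) :=
    ciInf_le ⟨0, by rintro _ ⟨B, rfl⟩; exact measureReal_nonneg⟩ _
  have hvec : ∀ x i, ((Matrix.of fun i j => B i j).mulVec (f x)) i =
      if L (π x) = i then 1 else 0 := by
    intro x i
    rw [← hB i x]
    simp [Matrix.mulVec, dotProduct, PiLp.inner_apply]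
  have hsub : M.probeError f (Matrix.of fun i j => B i j) ≤
      M.joint.real ({p | L (π p.2) ≠ g p.2} ∪ {p | g p.2 ≠ M.label p.1}) := by
    refine measureReal_mono ?_
    rintro p ⟨j, hj, hle⟩
    by_contra hp
    simp only [Set.mem_union, Set.mem_ofPred_eq, not_or, not_not] at hp
    rw [hvec, hvec, if_pos (hp.1.trans hp.2), if_neg] at hle
    · linarith
    · rw [hp.1, hp.2]
      exact hj.symm
  have hunion := measureReal_union_le (μ := M.joint) {p | L (π p.2) ≠ g p.2}
    {p | g p.2 ≠ M.label p.1}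
  -- As `1 - (1 - α) / d = ρ / d`, the claimed first term is twice the majority error bound; the
  -- claim has slack here and in `8 * δ`.
  have hgap : 4 * δ / (1 - (1 - α) / d) = 2 * (2 * δ * d / ρ) := by
    have : 1 - (1 - α) / d = ρ / d := by
      rw [eq_div_iff hd0.ne', sub_mul, div_mul_cancel₀ _ hd0.ne', hdρ]
      ring
    rw [this]
    field_simp
    ring
  have hpos : 0 ≤ 2 * δ * d / ρ := by positivity
  rw [hgap]
  linarith
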